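/- **Definitions.** A logic is a triple $L=\langle KB,BS,\mathrm{acc}\rangle$ of a set $KB$ of admissible knowledge bases (sets of formulas), a set $BS$ of possible belief sets (sets of beliefs), and a map $\mathrm{acc}:KB\to 2^{BS}$. The storage logic over a set $E$ has $KB=BS=2^E$ and $\mathrm{acc}(E')=\{E'\}$. A context is $C=\langle L,OP,\mathrm{mng}\rangle$ with a set $OP$ of operations and a management function $\mathrm{mng}:2^{OP}\times KB\to KB$. A reactive multi-context system (rMCS) $M$ consists of contexts $C_1,\dots,C_n$, input languages $IL_1,\dots,IL_m$, and for each $i$ a set $BR_i$ of bridge rules $h\leftarrow a_1,\dots,a_j,\mathbf{not}\,a_{j+1},\dots,\mathbf{not}\,a_r$, where $h=op$ or $h=\mathbf{next}(op)$ with $op\in OP_i$, and each atom is a context atom $c{:}b$ ($b$ in some possible belief set of $C_c$) or an input atom $s{::}b$ ($b\in IL_s$). A belief state is a tuple $B=(B_1,\dots,B_n)$ with $B_i\in BS_i$; an input is a tuple $I=(I_1,\dots,I_m)$ with $I_s\subseteq IL_s$; a configuration is a tuple $K=(K_1,\dots,K_n)$ with $K_i\in KB_i$. The atom $c{:}b$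 holds if $b\in B_c$, the atom $s{::}b$ holds if $b\in I_s$, and $\mathbf{not}\,a$ holds if $a$ does not. Let $\mathrm{app}^{now}_i(I,B)$ and $\mathrm{app}^{next}_i(I,B)$ be the sets of operations $op$ for which $op$, respectively $\mathbf{next}(op)$, is the head of a rule in $BR_i$ whose body holds. $B$ is an equilibrium given $K$ and $I$ if $B_i\in\mathrm{acc}_i(\mathrm{mng}_i(\mathrm{app}^{now}_i(I,B),K_i))$ for all $i$. Given an infinite input stream $(I^t)_{t\ge1}$ and a configuration $K$, an equilibria stream is a sequence $(B^t)_{t\ge1}$ of belief states such that each $B^t$ is an equilibrium given $K^t$ and $I^t$, where $K^1=K$ and $K^{t+1}_i=\mathrm{mng}_i(\mathrm{app}^{next}_i(I^t,B^t),K^t_i)$. An instance for infinite input streams ($\tau=\infty$) consists of a finite rMCS $M$ (each $BR_i$ is finite), an index $k$, a belief $b$ for the $k$-th context, a configuration $K$ of finite knowledge bases, and an infinite input stream. Problem $\mathbf E$ (respectively $\mathbf A$) asks whether for some (respectively every) equilibria stream $(B^t)_{t\ge1}$ given $K$ and the input stream there is a $t\ge 1$ with $b\in B^t_k$. **Proposition.**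 Problems $\mathbf E$ and $\mathbf A$ are undecidable for infinite input streams. More precisely, there is one fixed finite rMCS $M$, all of whose contexts use the storage logic over $\mathbb N$, with finite sets of operations, finite input languages, and management functions that map finite knowledge bases to finite knowledge bases and are primitive recursive on them, together with a fixed $k$ and a fixed belief $b$, such that, with all initial knowledge bases empty and the infinite input streams restricted to those that begin with a finite word of inputs and are empty afterwards (given by that word), the halting problem is many-one reducible to $\mathbf E$ and to $\mathbf A$, and both problems are undecidable. Consequently $\mathbf E$ and $\mathbf A$ are undecidable in every presentation of instances by finite data in which the instances just described can be effectively written down. -/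

import Mathlib

namespace ReactiveMCS

/-- A logic `⟨KB, BS, acc⟩`: admissible knowledge bases (sets of formulas), possible belief sets
(sets of beliefs), and the map from knowledge bases to sets of acceptable belief sets. -/
structure Logic where
  Formula : Type
  Belief : Type
  KB : Set (Set Formula)
  BS : Set (Set Belief)
  acc : KB → Set BS

/-- A context `⟨L, OP, mng⟩` with a deterministic management function `mng : 2^OP × KB → KB`. -/
structure Context where
  logic : Logic
  Op : Type
  mng : Set Op → logic.KB → logic.KB

/-- Atoms of bridge-rule bodies: context atoms `c:b`, where `b` occurs in some possible belief set
of context `c`, and input atoms `s::b`, where `b` belongs to the input language `s`. -/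
inductive Atom {n m : ℕ} (ctx : Fin n → Context) (IL : Fin m → Type) : Type
  | belief (c : Fin n) (b : (ctx c).logic.Belief) (hb : ∃ S ∈ (ctx c).logic.BS, b ∈ S) : Atom ctx IL
  | input (s : Fin m) (b : IL s) : Atom ctx IL

/-- Heads of bridge rules: `op` or `next(op)`. -/
inductive Head (Op : Type) : Type
  | now (op : Op) : Head Op
  | next (op : Op) : Head Op

/-- A bridge rule `head ← pos, not neg` for context `i`. -/
structure BridgeRule {n m : ℕ} (ctx : Fin n → Context) (IL : Fin m → Type) (i : Fin n) where
  head : Head (ctx i).Op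
  pos : List (Atom ctx IL)
  neg : List (Atom ctx IL)

/-- A reactive multi-context system with `n` contexts and `m` input languages. -/
structure RMCS where
  n : ℕ
  m : ℕ
  ctx : Fin n → Context
  IL : Fin m → Type
  br : (i : Fin n) → Set (BridgeRule ctx IL i)

namespace RMCS

variable (M : RMCS)

/-- Belief states: one possible belief set per context. -/
def BeliefState : Type := (i : Fin M.n) → (M.ctx i).logic.BS

/-- Inputs: one subset of each input language. -/
def Input : Type := (s : Fin M.m) → Set (M.IL s)

/-- Configurations of knowledge bases: one admissible knowledge base per context. -/
def Config : Type := (i : Fin M.n) → (M.ctx i).logic.KB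

/-- Satisfaction of an atom by an input and a belief state. -/
def SatAtom (I : M.Input) (B : M.BeliefState) : Atom M.ctx M.IL → Prop
  | .belief c b _ => b ∈ (B c : Set (M.ctx c).logic.Belief)
  | .input s b => b ∈ I s

/-- The body of the bridge rule `r` is satisfied. -/
def SatBody (I : M.Input) (B : M.BeliefState) {i : Fin M.n} (r : BridgeRule M.ctx M.IL i) : Prop :=
  (∀ a ∈ r.pos, M.SatAtom I B a) ∧ ∀ a ∈ r.neg, ¬ M.SatAtom I B a

/-- Operations `op` in heads `op` of applicable bridge rules of context `i`. -/
def appNow (I : M.Input) (B : M.BeliefState) (i : Fin M.n) : Set (M.ctx i).Op :=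
  {o | ∃ r ∈ M.br i, M.SatBody I B r ∧ r.head = Head.now o}

/-- Operations `op` in heads `next(op)` of applicable bridge rules of context `i`. -/
def appNext (I : M.Input) (B : M.BeliefState) (i : Fin M.n) : Set (M.ctx i).Op :=
  {o | ∃ r ∈ M.br i, M.SatBody I B r ∧ r.head = Head.next o}

/-- `B` is an equilibrium of `M` given `K` and `I`. -/
def IsEquilibrium (K : M.Config) (I : M.Input) (B : M.BeliefState) : Prop :=
  ∀ i, B i ∈ (M.ctx i).logic.acc ((M.ctx i).mng (M.appNow I B i) (K i))

/-- The update function of `M`. -/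
def upd (K : M.Config) (I : M.Input) (B : M.BeliefState) : M.Config :=
  fun i => (M.ctx i).mng (M.appNext I B i) (K i)

/-- The configurations stream of `M` given `K`, an infinite input stream and a stream of belief
states. The index `t : ℕ` stands for the time instant `t + 1`. -/
def kbStream (K : M.Config) (I : ℕ → M.Input) (B : ℕ → M.BeliefState) : ℕ → M.Config
  | 0 => K
  | t + 1 => M.upd (kbStream K I B t) (I t) (B t)

/-- `B` is an equilibria stream of `M` given `K` and the infinite input stream `I`. -/
def IsEquilibriaStream (K : M.Config) (I : ℕ → M.Input) (B : ℕ → M.BeliefState) : Prop :=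
  ∀ t, M.IsEquilibrium (M.kbStream K I B t) (I t) (B t)

end RMCS

/-- Instances of the reasoning problems for infinite input streams: a finite rMCS (finitely many
bridge rules, finite knowledge bases), a belief `b` for its `k`-th context, a configuration of
knowledge bases, and an infinite input stream. -/
structure Instance where
  M : RMCS
  finite_rules : ∀ i, (M.br i).Finite
  k : Fin M.n
  b : (M.ctx k).logic.Belief
  belief_mem : ∃ S ∈ (M.ctx k).logic.BS, b ∈ S
  K : M.Config
  finite_kb : ∀ i, (K i : Set (M.ctx i).logic.Formula).Finite
  I : ℕ → M.Input

/-- Problem E: some equilibria stream contains `b` in its `k`-th belief set at some time. -/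
def ProblemE (x : Instance) : Prop :=
  ∃ B : ℕ → x.M.BeliefState, x.M.IsEquilibriaStream x.K x.I B ∧
    ∃ t, x.b ∈ (B t x.k : Set (x.M.ctx x.k).logic.Belief)

/-- Problem A: every equilibria stream contains `b` in its `k`-th belief set at some time. -/
def ProblemA (x : Instance) : Prop :=
  ∀ B : ℕ → x.M.BeliefState, x.M.IsEquilibriaStream x.K x.I B →
    ∃ t, x.b ∈ (B t x.k : Set (x.M.ctx x.k).logic.Belief)

/-- The storage logic over a set `E` of entries: `KB = BS = 2^E` and `acc(E') = {E'}`. -/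
def storageLogic (E : Type) : Logic where
  Formula := E
  Belief := E
  KB := Set.univ
  BS := Set.univ
  acc := fun K => {K}

/-- The context with the storage logic over `ℕ`, with `p` operations and management function
`mng`. -/
def storageContext (p : ℕ) (mng : Set (Fin p) → Set ℕ → Set ℕ) : Context where
  logic := storageLogic ℕ
  Op := Fin p
  mng := fun O K => ⟨mng O K.1, Set.mem_univ _⟩

/-- The management function maps finite knowledge bases to finite knowledge bases, and is primitive
recursive on them; finite sets are given by lists of their elements. -/
def PrimrecManagement {p : ℕ} (mng : Set (Fin p) → Set ℕ → Set ℕ) : Prop :=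
  ∃ g : List (Fin p) → List ℕ → List ℕ, Primrec₂ g ∧
    ∀ (O : List (Fin p)) (K : List ℕ), mng {o | o ∈ O} {x | x ∈ K} = {y | y ∈ g O K}

/-- The rMCS with `n` storage contexts over `ℕ`, each with `p` operations, and with `m` input
languages of `q` symbols each. -/
def storageRMCS {n p : ℕ} (m q : ℕ) (mng : Fin n → Set (Fin p) → Set ℕ → Set ℕ)
    (br : (i : Fin n) → Set (BridgeRule (fun j => storageContext p (mng j))
      (fun _ : Fin m => Fin q) i)) : RMCS where
  n := n
  m := m
  ctx := fun j => storageContext p (mng j)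
  IL := fun _ => Fin q
  br := br

/-- The instance given by a finite storage rMCS, a belief `b` for its `k`-th context, empty initial
knowledge bases, and the infinite input stream that begins with the finite word `w` and is empty
from then on. Each letter of `w` lists the pairs (stream, symbol) present at its time instant. -/
def storageInstance {n p m q : ℕ} (mng : Fin n → Set (Fin p) → Set ℕ → Set ℕ)
    (br : (i : Fin n) → Set (BridgeRule (fun j => storageContext p (mng j))
      (fun _ : Fin m => Fin q) i))
    (hbr : ∀ i, (br i).Finite) (k : Fin n) (b : ℕ)
    (w : List (List (Fin m × Fin q))) : Instance where
  M := storageRMCS m q mng br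
  finite_rules := hbr
  k := k
  b := b
  belief_mem := ⟨Set.univ, Set.mem_univ _, Set.mem_univ _⟩
  K := fun _ => ⟨(∅ : Set ℕ), Set.mem_univ _⟩
  finite_kb := fun _ => Set.finite_empty
  I := fun t s => {x | (s, x) ∈ w.getD t []}

end ReactiveMCS

namespace ReactiveMCS

/-! ### Step-bounded halting tests on entries -/

open Nat.Partrec (Code)
open Encodable (encode decode)

/-! A single storage context can run an arbitrary computation if its management function performs
one step-bounded test per time instant. Alphabet and operations are finite, so the code `N` is
supplied in unary: one letter creates an entry, then `N` letters increment it. The empty letters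
that follow forever trigger, by negated input atoms, a test with bounds 0, 1, 2, ...; a success
turns the entry into 0, the queried belief. All heads are `next`, no body mentions a belief and
`acc` is single-valued, so there is exactly one equilibria stream
(`simInstance_isEquilibriaStream_iff`). Hence E and A coincide, and both say that 0 appears, i.e.
that the computation halts (`exists_zero_mem_simKB_startWord_iff`). -/

/-- The computation encoded by `N` yields a value within `t` steps. -/
def haltsWithin (t N : ℕ) : Bool :=
  ((decode (α := Code × ℕ) N).bind fun c => Code.evaln t c.1 c.2).isSome

theorem primrec₂_haltsWithin : Primrec₂ haltsWithin :=
  Primrec.option_isSome.comp <|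
    Primrec.option_bind (Primrec.decode.comp Primrec.snd) <|
      Code.primrec_evaln.comp <|
        ((Primrec.fst.comp Primrec.fst).pair (Primrec.fst.comp Primrec.snd)).pair
          (Primrec.snd.comp Primrec.snd)

theorem eval_dom_iff_exists_haltsWithin (c : Code × ℕ) :
    (c.1.eval c.2).Dom ↔ ∃ t, haltsWithin t (encode c) = true := by
  simp only [haltsWithin, Encodable.encodek, Option.bind_some, Part.dom_iff_mem,
    Code.evaln_complete, Option.isSome_iff_exists, Option.mem_def]
  exact exists_comm

/-- The entry recording that `t` steps of the computation encoded by `N` have been tried. -/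
def runningEntry (t N : ℕ) : ℕ := Nat.pair t N + 1

/-- The successor in `runningEntry` reserves 0 as the mark of halting. -/
theorem runningEntry_ne_zero (t N : ℕ) : runningEntry t N ≠ 0 := Nat.succ_ne_zero _

/-- Increments the computation code of a running entry; `0` records that the computation halted. -/
def incEntry (x : ℕ) : ℕ :=
  if x = 0 then 0 else runningEntry x.pred.unpair.1 (x.pred.unpair.2 + 1)

/-- Tests whether the computation of a running entry halts within its step bound, and raises the
bound if not. -/
def runEntry (x : ℕ) : ℕ :=
  if x = 0 then 0
  else if haltsWithin x.pred.unpair.1 x.pred.unpair.2 = true then 0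
  else runningEntry (x.pred.unpair.1 + 1) x.pred.unpair.2

@[simp] theorem incEntry_runningEntry (t N : ℕ) :
    incEntry (runningEntry t N) = runningEntry t (N + 1) := by
  simp [incEntry, runningEntry]

@[simp] theorem runEntry_runningEntry (t N : ℕ) :
    runEntry (runningEntry t N) = if haltsWithin t N = true then 0 else runningEntry (t + 1) N := by
  simp [runEntry, runningEntry]

@[simp] theorem runEntry_zero : runEntry 0 = 0 := rfl

theorem primrec₂_runningEntry : Primrec₂ runningEntry :=
  Primrec.succ.comp Primrec₂.natPair

theorem primrec_incEntry : Primrec incEntry :=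
  have h := Primrec.unpair.comp Primrec.pred
  Primrec.ite (Primrec.eq.comp Primrec.id (Primrec.const 0)) (Primrec.const 0)
    (primrec₂_runningEntry.comp (Primrec.fst.comp h) (Primrec.succ.comp (Primrec.snd.comp h)))

theorem primrec_runEntry : Primrec runEntry :=
  have h := Primrec.unpair.comp Primrec.pred
  Primrec.ite (Primrec.eq.comp Primrec.id (Primrec.const 0)) (Primrec.const 0) <|
    Primrec.ite
      (Primrec.eq.comp (primrec₂_haltsWithin.comp (Primrec.fst.comp h) (Primrec.snd.comp h))
        (Primrec.const true))
      (Primrec.const 0)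
      (primrec₂_runningEntry.comp (Primrec.succ.comp (Primrec.fst.comp h)) (Primrec.snd.comp h))

/-! ### The management function -/

/-- The management function: operation `0` adds the entry for the computation with code `0`,
operation `1` increments the code of every entry, operation `2` runs every entry. -/
def simulate (O : Set (Fin 3)) (K : Set ℕ) : Set ℕ :=
  {y | (0 ∈ O ∧ y = runningEntry 0 0) ∨ (1 ∈ O ∧ y ∈ incEntry '' K) ∨
    (2 ∈ O ∧ y ∈ runEntry '' K) ∨ (1 ∉ O ∧ 2 ∉ O ∧ y ∈ K)}

/-- `idxOf` returns the length of the list exactly when the element is absent. -/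
theorem primrecPred_mem_list {α : Type} [Primcodable α] [DecidableEq α] (a : α) :
    PrimrecPred fun l : List α => a ∈ l :=
  (Primrec.nat_lt.comp (Primrec.list_idxOf.comp (Primrec.const a) Primrec.id)
    Primrec.list_length).of_eq fun _ => List.idxOf_lt_length_iff

theorem primrecManagement_simulate : PrimrecManagement simulate := by
  refine ⟨fun O K => (if 0 ∈ O then [runningEntry 0 0] else []) ++
    ((if 1 ∈ O then K.map incEntry else []) ++ ((if 2 ∈ O then K.map runEntry else []) ++
      (if 1 ∈ O then [] else if 2 ∈ O then [] else K))), ?_, fun O K => ?_⟩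
  · have hm (o : Fin 3) : PrimrecPred fun x : List (Fin 3) × List ℕ => o ∈ x.1 :=
      (primrecPred_mem_list o).comp Primrec.fst
    have hmap {f : ℕ → ℕ} (hf : Primrec f) :
        Primrec fun x : List (Fin 3) × List ℕ => x.2.map f :=
      Primrec.list_map Primrec.snd (hf.comp Primrec.snd).to₂
    exact Primrec.list_append.comp (Primrec.ite (hm 0) (Primrec.const _) (Primrec.const _)) <|
      Primrec.list_append.comp (Primrec.ite (hm 1) (hmap primrec_incEntry) (Primrec.const _)) <|
      Primrec.list_append.comp (Primrec.ite (hm 2) (hmap primrec_runEntry) (Primrec.const _)) <|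
      Primrec.ite (hm 1) (Primrec.const _) (Primrec.ite (hm 2) (Primrec.const _) Primrec.snd)
  · ext y
    simp only [simulate, Set.mem_ofPred_eq, Set.mem_image, List.mem_append]
    by_cases h0 : 0 ∈ O <;> by_cases h1 : 1 ∈ O <;> by_cases h2 : 2 ∈ O <;> simp [h0, h1, h2]

/-- Management also acts when belief sets are formed, where no operation is ever applicable; inertia
makes the belief set equal the knowledge base. -/
theorem simulate_empty (K : Set ℕ) : simulate ∅ K = K := by
  ext y; simp [simulate]

theorem simulate_init : simulate {0} ∅ = {runningEntry 0 0} := by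
  ext y; simp [simulate]

theorem simulate_inc (K : Set ℕ) : simulate {1} K = incEntry '' K := by
  ext y; simp [simulate]

theorem simulate_run (K : Set ℕ) : simulate {2} K = runEntry '' K := by
  ext y; simp [simulate]

/-! ### The rMCS and its unique equilibria stream -/

/-- The contexts of the simulating rMCS. -/
abbrev simCtx : Fin 1 → Context := fun _ => storageContext 3 simulate

/-- The input languages of the simulating rMCS. -/
abbrev simIL : Fin 1 → Type := fun _ => Fin 2

/-- The rule `next(0) ← 0::0`. -/
def initRule (i : Fin 1) : BridgeRule simCtx simIL i where
  head := .next (0 : Fin 3)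
  pos := [.input 0 (0 : Fin 2)]
  neg := []

/-- The rule `next(1) ← 0::1`. -/
def incRule (i : Fin 1) : BridgeRule simCtx simIL i where
  head := .next (1 : Fin 3)
  pos := [.input 0 (1 : Fin 2)]
  neg := []

/-- The rule `next(2) ← not 0::0, not 0::1`. -/
def runRule (i : Fin 1) : BridgeRule simCtx simIL i where
  head := .next (2 : Fin 3)
  pos := []
  neg := [.input 0 (0 : Fin 2), .input 0 (1 : Fin 2)]

/-- The bridge rules of the simulating rMCS. -/
def simRules (i : Fin 1) : Set (BridgeRule simCtx simIL i) :=
  {initRule i, incRule i, runRule i}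

theorem simRules_finite (i : Fin 1) : (simRules i).Finite := by
  simp [simRules]

/-- The simulating rMCS. -/
abbrev simRMCS : RMCS := storageRMCS 1 2 (fun _ => simulate) simRules

theorem simRMCS_appNow (I : simRMCS.Input) (B : simRMCS.BeliefState) (i : Fin 1) :
    simRMCS.appNow I B i = ∅ := by
  refine Set.eq_empty_of_forall_notMem ?_
  rintro o ⟨r, hr, -, hh⟩
  rcases hr with rfl | rfl | rfl <;> cases hh

/-- The operations triggered for the next configuration by an input letter. -/
def letterOps (l : List (Fin 1 × Fin 2)) : Set (Fin 3) :=
  {o | (o = 0 ∧ (0, 0) ∈ l) ∨ (o = 1 ∧ (0, 1) ∈ l) ∨ (o = 2 ∧ (0, 0) ∉ l ∧ (0, 1) ∉ l)}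

/-- Bodies contain only input atoms, so the belief state has no influence. -/
theorem simRMCS_appNext (l : List (Fin 1 × Fin 2)) (B : simRMCS.BeliefState) (i : Fin 1) :
    simRMCS.appNext (fun s => {x | (s, x) ∈ l}) B i = letterOps l := by
  ext o
  constructor
  · rintro ⟨r, hr, ⟨hp, hn⟩, hh⟩
    rcases hr with rfl | rfl | rfl
    · cases hh
      exact .inl ⟨rfl, hp _ (List.mem_singleton_self _)⟩
    · cases hh
      exact .inr (.inl ⟨rfl, hp _ (List.mem_singleton_self _)⟩)
    · cases hh
      exact .inr (.inr ⟨rfl, hn _ List.mem_cons_self,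
        hn _ (List.mem_cons_of_mem _ (List.mem_singleton_self _))⟩)
  · rintro (⟨rfl, h⟩ | ⟨rfl, h⟩ | ⟨rfl, h, h'⟩)
    · refine ⟨initRule i, .inl rfl, ⟨fun a ha => ?_, fun a ha => ?_⟩, rfl⟩
      · cases List.mem_singleton.1 ha; exact h
      · cases ha
    · refine ⟨incRule i, .inr (.inl rfl), ⟨fun a ha => ?_, fun a ha => ?_⟩, rfl⟩
      · cases List.mem_singleton.1 ha; exact h
      · cases ha
    · refine ⟨runRule i, .inr (.inr rfl), ⟨fun a ha => ?_, fun a ha => ?_⟩, rfl⟩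
      · cases ha
      · rcases List.mem_cons.1 ha with rfl | ha
        · exact h
        · cases List.mem_singleton.1 ha; exact h'

/-- The knowledge base of the simulating rMCS at each time instant, for the input word `w`. -/
def simKB (w : List (List (Fin 1 × Fin 2))) : ℕ → Set ℕ
  | 0 => ∅
  | t + 1 => simulate (letterOps (w.getD t [])) (simKB w t)

/-- The instance of the reasoning problems given by the simulating rMCS, the belief `0` and an
input word. -/
abbrev simInstance (w : List (List (Fin 1 × Fin 2))) : Instance :=
  storageInstance (fun _ => simulate) simRules simRules_finite 0 0 w

theorem simInstance_kbStream (w : List (List (Fin 1 × Fin 2))) (B : ℕ → simRMCS.BeliefState)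
    (t : ℕ) (i : Fin 1) :
    (simRMCS.kbStream (simInstance w).K (simInstance w).I B t i).1 = simKB w t := by
  induction t with
  | zero => rfl
  | succ t ih => exact congrArg₂ simulate (simRMCS_appNext (w.getD t []) (B t) i) ih

/-- Knowledge bases do not depend on beliefs, and the storage logic accepts only the knowledge base
itself, so each belief set is forced. -/
theorem simInstance_isEquilibriaStream_iff (w : List (List (Fin 1 × Fin 2)))
    (B : ℕ → simRMCS.BeliefState) :
    simRMCS.IsEquilibriaStream (simInstance w).K (simInstance w).I B ↔
      B = fun t _ => ⟨simKB w t, Set.mem_univ _⟩ := by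
  have key (t : ℕ) (i : Fin 1) :
      simulate (simRMCS.appNow ((simInstance w).I t) (B t) i)
        (simRMCS.kbStream (simInstance w).K (simInstance w).I B t i).1 = simKB w t :=
    (congrArg₂ simulate (simRMCS_appNow _ _ i) (simInstance_kbStream w B t i)).trans
      (simulate_empty _)
  constructor
  · intro h
    funext t i
    exact Subtype.ext ((congrArg Subtype.val (h t i)).trans (key t i))
  · intro h t i
    exact Subtype.ext ((congrArg Subtype.val (congrFun (congrFun h t) i)).trans (key t i).symm)

theorem problemE_simInstance_iff (w : List (List (Fin 1 × Fin 2))) :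
    ProblemE (simInstance w) ↔ ∃ t, 0 ∈ simKB w t := by
  constructor
  · rintro ⟨B, hB, t, ht⟩
    rw [(simInstance_isEquilibriaStream_iff w B).1 hB] at ht
    exact ⟨t, ht⟩
  · rintro ⟨t, ht⟩
    exact ⟨_, (simInstance_isEquilibriaStream_iff w _).2 rfl, t, ht⟩

theorem problemA_simInstance_iff (w : List (List (Fin 1 × Fin 2))) :
    ProblemA (simInstance w) ↔ ∃ t, 0 ∈ simKB w t := by
  constructor
  · intro h
    exact h _ ((simInstance_isEquilibriaStream_iff w _).2 rfl)
  · rintro ⟨t, ht⟩ B hB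
    rw [(simInstance_isEquilibriaStream_iff w B).1 hB]
    exact ⟨t, ht⟩

/-! ### Evolution on a start word -/

/-- The input word that starts the computation with code `N`. -/
def startWord (N : ℕ) : List (List (Fin 1 × Fin 2)) :=
  [(0, 0)] :: (List.range N).map fun _ => [(0, 1)]

theorem primrec_startWord : Primrec startWord :=
  Primrec.list_cons.comp (Primrec.const _) <|
    Primrec.list_map Primrec.list_range (Primrec.const _).to₂

theorem letterOps_init : letterOps [(0, 0)] = {0} := by
  ext o; simp [letterOps]

theorem letterOps_inc : letterOps [(0, 1)] = {1} := by
  ext o; simp [letterOps]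

theorem letterOps_nil : letterOps [] = {2} := by
  ext o; simp [letterOps]

theorem simKB_startWord_of_le {N t : ℕ} (h : t ≤ N) :
    simKB (startWord N) (t + 1) = {runningEntry 0 t} := by
  induction t with
  | zero =>
    change simulate (letterOps [(0, 0)]) ∅ = _
    rw [letterOps_init, simulate_init]
  | succ t ih =>
    have hw : (startWord N).getD (t + 1) [] = [(0, 1)] := by
      simp [startWord, show t < N by omega]
    rw [simKB, hw, letterOps_inc, simulate_inc, ih (by omega), Set.image_singleton,
      incEntry_runningEntry]

open Classical in
-- After the `N + 1` letters of the word, `s` further instants have tried the bounds below `s`.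
theorem simKB_startWord_add (N s : ℕ) :
    simKB (startWord N) (N + 1 + s) =
      {if ∃ r < s, haltsWithin r N = true then 0 else runningEntry s N} := by
  induction s with
  | zero => simpa using simKB_startWord_of_le le_rfl
  | succ s ih =>
    -- The word has length `N + 1`, so the letter here is the empty default, which triggers
    -- operation 2.
    have hw : (startWord N).getD (N + 1 + s) [] = [] :=
      List.getD_eq_default _ _ (by simp [startWord])
    rw [← add_assoc, simKB, hw, letterOps_nil, simulate_run, ih, Set.image_singleton]
    simp only [Nat.exists_lt_succ_right]
    -- A halted entry stays 0; otherwise the test with bound `s` decides.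
    by_cases h : ∃ r < s, haltsWithin r N = true <;> simp [h]

theorem exists_zero_mem_simKB_startWord_iff (N : ℕ) :
    (∃ t, 0 ∈ simKB (startWord N) t) ↔ ∃ t, haltsWithin t N = true := by
  classical
  constructor
  · rintro ⟨t, ht⟩
    rcases t with _ | t
    · exact ht.elim
    rcases le_total t N with h | h
    · rw [simKB_startWord_of_le h] at ht
      exact (runningEntry_ne_zero _ _ ht.symm).elim
    · obtain ⟨s, rfl⟩ := Nat.exists_eq_add_of_le h
      rw [show N + s + 1 = N + 1 + s by omega, simKB_startWord_add] at ht
      by_contra hn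
      rw [if_neg fun ⟨r, _, hr⟩ => hn ⟨r, hr⟩] at ht
      exact runningEntry_ne_zero _ _ ht.symm
  · rintro ⟨t, ht⟩
    -- `N + 1` instants write the code, and `t + 1` more test the bounds 0 to `t`.
    refine ⟨N + 1 + (t + 1), ?_⟩
    rw [simKB_startWord_add, if_pos ⟨t, t.lt_succ_self, ht⟩]
    rfl

/-! ### Reductions from the halting problem -/

theorem halting_manyOneReducible {p : List (List (Fin 1 × Fin 2)) → Prop}
    (hp : ∀ w, p w ↔ ∃ t, 0 ∈ simKB w t) :
    (fun c : Code × ℕ => (c.1.eval c.2).Dom) ≤₀ p :=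
  ⟨fun c => startWord (encode c), (primrec_startWord.comp Primrec.encode).to_comp, fun c =>
    (eval_dom_iff_exists_haltsWithin c).trans <|
      (exists_zero_mem_simKB_startWord_iff _).symm.trans (hp _).symm⟩

/-- Halting on the fixed argument 0 is already undecidable and reduces to halting on pairs. -/
theorem not_computablePred_of_halting_manyOneReducible {α : Type} [Primcodable α] {p : α → Prop}
    (hp : (fun c : Code × ℕ => (c.1.eval c.2).Dom) ≤₀ p) : ¬ ComputablePred p := fun h =>
  ComputablePred.halting_problem 0 <| ComputablePred.computable_of_manyOneReducible
    (ManyOneReducible.trans ⟨fun c => (c, 0), Computable.id.pair (Computable.const 0),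
      fun _ => Iff.rfl⟩ hp) h

end ReactiveMCS

open ReactiveMCS in
theorem mainTheorem2 :
    ∃ (n p m q : ℕ) (mng : Fin n → Set (Fin p) → Set ℕ → Set ℕ)
      (br : (i : Fin n) → Set (BridgeRule (fun j => storageContext p (mng j))
        (fun _ : Fin m => Fin q) i))
      (hbr : ∀ i, (br i).Finite) (k : Fin n) (b : ℕ),
      (∀ i, PrimrecManagement (mng i)) ∧
      -- for this one fixed finite rMCS, the halting problem reduces to both problems
      ((fun c : Nat.Partrec.Code × ℕ => (c.1.eval c.2).Dom) ≤₀
        (fun w => ProblemE (storageInstance mng br hbr k b w))) ∧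
      ((fun c : Nat.Partrec.Code × ℕ => (c.1.eval c.2).Dom) ≤₀
        (fun w => ProblemA (storageInstance mng br hbr k b w))) ∧
      -- and both problems are undecidable
      (¬ ComputablePred (fun w => ProblemE (storageInstance mng br hbr k b w))) ∧
      (¬ ComputablePred (fun w => ProblemA (storageInstance mng br hbr k b w))) ∧
      -- hence so are the unrestricted problems, in every presentation of instances by finite
      -- data in which the instances above can be written down effectively
      (∀ (α : Type) [Primcodable α] (inst : α → Instance)
        (enc : List (List (Fin m × Fin q)) → α), Computable enc →
        (∀ w, inst (enc w) = storageInstance mng br hbr k b w) →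
        (¬ ComputablePred (fun a => ProblemE (inst a))) ∧
        (¬ ComputablePred (fun a => ProblemA (inst a)))) := by
  have hE := halting_manyOneReducible problemE_simInstance_iff
  have hA := halting_manyOneReducible problemA_simInstance_iff
  refine ⟨1, 3, 1, 2, fun _ => simulate, simRules, simRules_finite, 0, 0,
    fun _ => primrecManagement_simulate, hE, hA,
    not_computablePred_of_halting_manyOneReducible hE,
    not_computablePred_of_halting_manyOneReducible hA, fun α _ inst enc henc hinst => ⟨?_, ?_⟩⟩
  · exact not_computablePred_of_halting_manyOneReducible
      (hE.trans ⟨enc, henc, fun w => iff_of_eq (congrArg ProblemE (hinst w).symm)⟩)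
  · exact not_computablePred_of_halting_manyOneReducible
      (hA.trans ⟨enc, henc, fun w => iff_of_eq (congrArg ProblemA (hinst w).symm)⟩)
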